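/- Let $E$ be a finite set of items and $O$ a finite set of states. The state $Y_e\in O$ of item $e$ is random with a known law $D_e$, and the states are independent, so that $y=(y_e)_{e\in E}$ is drawn from $\prod_{e\in E} D_e$. Let $\mathcal I$ be a downward-closed family of subsets of $E$, let $m\ge 1$, $\epsilon\in(0,1]$, and let $\mathcal F=\{f_1,\dots,f_m\}$ be monotone functions $f_i:2^{E\times O}\to\mathbb R_{\ge 0}$, each $\epsilon$-nearly submodular: there is a non-negative submodular (not necessarily monotone) function $g_i$ on $2^{E\times O}$ with $\epsilon g_i(X)\le f_i(X)\le \frac1\epsilon g_i(X)$ for all $X\subseteq E\times O$. A deterministic adaptive policy selects, from the set of (item, state) pairs observed so far, the next item to pick or stops; an adaptive policy $\pi$ is a deterministic one or a random choice of one. It is feasible if, for every realization $y$ and every outcome of its coins, the set of picked items belongs to $\mathcal I$. Let $\mathcal U(\pi,f_i)$ be the expected value of $f_i$ at the set of all picked items with their states, and $\mathcal U(\pi,\mathcal F)=\min_{i}\mathcal U(\pi,f_i)$. For $S\subseteq E$ let $\mathcal U(S,f_i)=\mathbb E_y\big[f_i(\{(e,y_e):e\in S\})\big]$. A non-adaptive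 policy $\sigma$ is a random subset $S_\sigma$ of $E$; it is feasible if $S_\sigma\in\mathcal I$ always, $\mathcal U(\sigma,f_i)=\mathbb E[\mathcal U(S_\sigma,f_i)]$, and $\mathcal U(\sigma,\mathcal F)=\min_i\mathcal U(\sigma,f_i)$. Let $\mathrm{APPROX}$ be a (deterministic) step-by-step procedure that, for each $i\in\{1,\dots,m\}$, given the problem $\max_{S\in\mathcal I}\mathcal U(S,f_i)$, returns after at least one and at most $\delta$ steps a set $E_i\in\mathcal I$ with $\mathcal U(E_i,f_i)\ge \alpha_i\,\mathcal U(S,f_i)$ for all $S\in\mathcal I$, and let $\alpha=\min_i\alpha_i$. The algorithm $\sigma^{1/m}$ calls $\mathrm{APPROX}$ in a loop over $i=1,\dots,m$, stores the answers $E_i$, then draws an index $j\in\{1,\dots,m\}$ uniformly at random and returns $E_j$. Theorem. The random set returned by $\sigma^{1/m}$ is a feasible non-adaptive policy, and for every feasible adaptive policy $\pi$, in particular for an optimal one $\pi=\pi^*$, $$\mathcal U(\sigma^{1/m},\mathcal F)\ \ge\ \frac{\epsilon^2\alpha}{2m}\,\mathcal U(\pi,\mathcal F).$$ Moreover $\sigma^{1/m}$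 runs in time $O(m\delta)$: there is an absolute constant $C$ such that, in every such instance and for every outcome of its random draw, it halts after at most $C\,m\,\delta$ steps, where every step of $\mathrm{APPROX}$ and every assignment, comparison, uniform random draw of an index, and return of the algorithm itself counts as one step. -/

import Mathlib

namespace ARONSS

section Functions

/-- A non-negative submodular set function on a finite ground set. -/
def IsSubmodular {Ω : Type*} [DecidableEq Ω] (h : Finset Ω → ℝ) : Prop :=
  (∀ S, 0 ≤ h S) ∧
    ∀ S₁ S₂ : Finset Ω, S₁ ⊆ S₂ → ∀ v, v ∉ S₂ →
      h (insert v S₂) - h S₂ ≤ h (insert v S₁) - h S₁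

/-- `f` is `ε`-nearly submodular: it is within a factor `ε` of a submodular function,
which need not be monotone. -/
def IsNearlySubmodular {Ω : Type*} [DecidableEq Ω] (ε : ℝ) (f : Finset Ω → ℝ) : Prop :=
  ∃ g : Finset Ω → ℝ, IsSubmodular g ∧ ∀ X, ε * g X ≤ f X ∧ f X ≤ 1 / ε * g X

end Functions

section Probability

/-- Expectation of a real function under a discrete distribution (every distribution used
below lives on a finite set or has finite support, so the sum always converges). -/
noncomputable def expect {A : Type*} (p : PMF A) (φ : A → ℝ) : ℝ :=
  ∑' a, (p a).toReal * φ a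

/-- The joint law of the states of all items: the product of the laws `D e`. -/
noncomputable def prior {E O : Type*} [Fintype E] [DecidableEq E] [Fintype O]
    (D : E → PMF O) : PMF (E → O) :=
  PMF.ofFintype (fun y => ∏ e, D e (y e)) (by
    rw [← Fintype.piFinset_univ, ← Finset.prod_univ_sum]
    refine Finset.prod_eq_one fun e _ => ?_
    rw [← tsum_fintype (L := SummationFilter.unconditional O)]
    exact (D e).tsum_coe)

end Probability

section Policies

variable {E O : Type*} [Fintype E] [DecidableEq E] [Fintype O] [DecidableEq O]

/-- A deterministic adaptive policy: from the set of (item, state) pairs observed so far it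
selects the next item to pick, or stops (`none`). -/
abbrev DetPolicy (E O : Type*) : Type _ := Finset (E × O) → Option E

/-- The observations of the policy after `t` rounds if the realization is `y`. Selecting an
item a second time reveals nothing new, so from then on nothing changes. -/
def DetPolicy.observed (p : DetPolicy E O) (y : E → O) : ℕ → Finset (E × O)
  | 0 => ∅
  | t + 1 =>
    match p (DetPolicy.observed p y t) with
    | none => DetPolicy.observed p y t
    | some e => insert (e, y e) (DetPolicy.observed p y t)

/-- The set of all items (with their states) that the policy picks under the realization `y`;
there are at most `Fintype.card E` rounds in which something new is picked. -/
def DetPolicy.picked (p : DetPolicy E O) (y : E → O) : Finset (E × O) :=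
  DetPolicy.observed p y (Fintype.card E)

/-- The set of all items that the policy picks under the realization `y`. -/
def DetPolicy.items (p : DetPolicy E O) (y : E → O) : Finset E :=
  (DetPolicy.picked p y).image Prod.fst

/-- Expected reward of a deterministic adaptive policy. -/
noncomputable def DetPolicy.utility (D : E → PMF O) (f : Finset (E × O) → ℝ)
    (p : DetPolicy E O) : ℝ :=
  expect (prior D) fun y => f (DetPolicy.picked p y)

/-- A (possibly randomized) adaptive policy: a law on deterministic policies, the
deterministic ones being the point masses. -/
abbrev AdaptivePolicy (E O : Type*) : Type _ := PMF (DetPolicy E O)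

/-- Whatever the coins and the states, the set of items picked is in `I`. -/
def AdaptivePolicy.Feasible (I : Set (Finset E)) (π : AdaptivePolicy E O) : Prop :=
  ∀ p ∈ π.support, ∀ y : E → O, DetPolicy.items p y ∈ I

/-- Expected reward of an adaptive policy for a single reward function. -/
noncomputable def AdaptivePolicy.utility (D : E → PMF O) (f : Finset (E × O) → ℝ)
    (π : AdaptivePolicy E O) : ℝ :=
  expect π fun p => DetPolicy.utility D f p

/-- Worst-case utility of an adaptive policy over the reward functions `F 0, …, F (m - 1)`. -/
noncomputable def AdaptivePolicy.robustUtility {m : ℕ} (D : E → PMF O)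
    (F : Fin m → Finset (E × O) → ℝ) (π : AdaptivePolicy E O) : ℝ :=
  ⨅ i, AdaptivePolicy.utility D (F i) π

/-- Expected reward of picking the items of `S`, irrespective of their states. -/
noncomputable def setUtility (D : E → PMF O) (f : Finset (E × O) → ℝ) (S : Finset E) : ℝ :=
  expect (prior D) fun y => f (S.image fun e => (e, y e))

/-- A (randomized) non-adaptive policy: a law on sets of items. -/
abbrev NonadaptivePolicy (E : Type*) : Type _ := PMF (Finset E)

def NonadaptivePolicy.Feasible (I : Set (Finset E)) (σ : NonadaptivePolicy E) : Prop :=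
  ∀ S ∈ σ.support, S ∈ I

/-- Expected reward of a non-adaptive policy for a single reward function. -/
noncomputable def NonadaptivePolicy.utility (D : E → PMF O) (f : Finset (E × O) → ℝ)
    (σ : NonadaptivePolicy E) : ℝ :=
  expect σ fun S => setUtility D f S

/-- Worst-case utility of a non-adaptive policy over the reward functions. -/
noncomputable def NonadaptivePolicy.robustUtility {m : ℕ} (D : E → PMF O)
    (F : Fin m → Finset (E × O) → ℝ) (σ : NonadaptivePolicy E) : ℝ :=
  ⨅ i, NonadaptivePolicy.utility D (F i) σ

end Policies

section Oracles

/-- An instance of the problem of maximizing `setUtility prior reward S` over `S ∈ feasible`. -/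
structure SingleProblem (E O : Type*) where
  feasible : Set (Finset E)
  prior : E → PMF O
  reward : Finset (E × O) → ℝ

/-- A procedure that answers queries in `Q` by elements of `A`, as a transition system: one
step leads to the next configuration or returns the answer. -/
structure Procedure (Q A : Type*) where
  Cfg : Type*
  start : Q → Cfg
  step : Cfg → Cfg ⊕ A

/-- From the configuration `c`, the procedure returns the answer `a` after exactly `t` steps. -/
inductive Procedure.Returns {Q A : Type*} (M : Procedure Q A) : M.Cfg → ℕ → A → Prop
  | done {c : M.Cfg} {a : A} : M.step c = Sum.inr a → Procedure.Returns M c 1 a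
  | next {c c' : M.Cfg} {t : ℕ} {a : A} :
      M.step c = Sum.inl c' → Procedure.Returns M c' t a → Procedure.Returns M c (t + 1) a

/-- On the instance `q`, the procedure returns within `δ` steps a feasible set whose value is at
least `α` times that of every feasible set. -/
def ApproximatesWithin {E O : Type*} [Fintype E] [DecidableEq E] [Fintype O] [DecidableEq O]
    (M : Procedure (SingleProblem E O) (Finset E)) (q : SingleProblem E O)
    (α : ℝ) (δ : ℕ) : Prop :=
  ∃ (t : ℕ) (S : Finset E), t ≤ δ ∧ M.Returns (M.start q) t S ∧ S ∈ q.feasible ∧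
    ∀ S' ∈ q.feasible, α * setUtility q.prior q.reward S' ≤ setUtility q.prior q.reward S

end Oracles

section Algorithm

variable {E O : Type*} {m : ℕ}

/-- Configurations of the algorithm `σ^{1/m}` that runs, with `APPROX` as a subroutine,
```
i := 0
while i < m:
  T[i] := APPROX (max over S in I of U(S, f_i))
  i := i + 1
draw j from {0, ..., m - 1} uniformly at random
return T[j]
```
A configuration consists of the current line and the contents of the memory; during a call
of the subroutine it also holds the configuration of the subroutine. -/
inductive Config (m : ℕ) (M : Procedure (SingleProblem E O) (Finset E))
  | init
  | test (i : ℕ) (T : Fin m → Finset E)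
  | call (i : Fin m) (T : Fin m → Finset E) (c : M.Cfg)
  | incr (i : Fin m) (T : Fin m → Finset E)
  | draw (T : Fin m → Finset E)
  | ret (T : Fin m → Finset E) (j : Fin m)
  | halted (S : Finset E)

/-- One step of the algorithm. Every step of the subroutine is one step of the algorithm, and so
is every assignment, comparison, uniform random draw of an index, and the return. -/
noncomputable def step [NeZero m] (M : Procedure (SingleProblem E O) (Finset E))
    (q : Fin m → SingleProblem E O) : Config m M → PMF (Config m M)
  | .init => PMF.pure (.test 0 fun _ => ∅)
  | .test i T =>
      if h : i < m then PMF.pure (.call ⟨i, h⟩ T (M.start (q ⟨i, h⟩)))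
      else PMF.pure (.draw T)
  | .call i T c =>
      match M.step c with
      | .inl c' => PMF.pure (.call i T c')
      | .inr S => PMF.pure (.incr i (Function.update T i S))
  | .incr i T => PMF.pure (.test (i + 1) T)
  | .draw T => (PMF.uniformOfFintype (Fin m)).map (.ret T)
  | .ret T j => PMF.pure (.halted (T j))
  | .halted S => PMF.pure (.halted S)

/-- The law of the configuration of the algorithm after `t` steps. -/
noncomputable def run [NeZero m] (M : Procedure (SingleProblem E O) (Finset E))
    (q : Fin m → SingleProblem E O) : ℕ → PMF (Config m M)
  | 0 => PMF.pure .init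
  | t + 1 => (run M q t).bind (step M q)

/-- After `t` steps the algorithm has halted, whatever its coins, and the law of its output is
`σ`; that is, `σ` is the non-adaptive policy that the algorithm carries out. -/
def HaltsWith [NeZero m] (M : Procedure (SingleProblem E O) (Finset E))
    (q : Fin m → SingleProblem E O) (t : ℕ) (σ : NonadaptivePolicy E) : Prop :=
  run M q t = σ.map Config.halted

end Algorithm

end ARONSS

/-!
Adaptivity can help by at most a factor `2 / ε ^ 2`, and the algorithm loses a further `α / m`.

*Reduction to monotone submodular functions.* If `ε g ≤ f ≤ g / ε` with `f` monotone and `g`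
submodular, then `g` can be replaced by its monotone closure `X ↦ min {g Y | X ⊆ Y}`, which is
monotone and submodular and lies within the same factors of `f`
(`IsNearlySubmodular.exists_monotone`).

*Adaptivity gap.* Let a deterministic policy `p` run on a realization `y`, and let `z` be an
independent second realization. Write `A` for the pairs that `p` observes, and `B` (`resampled`)
for the items that `p` picks under `y`, taken with their states under `z`. When `p` picks a new
item `e`, submodularity bounds the growth of `g (A ∪ B)` by the sum of the marginal values of
`(e, y e)` and `(e, z e)` with respect to `B`. Both have the same expectation, because exchanging
`y e` and `z e` preserves the joint law and does not alter the history before `e` is picked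
(`swapNew`). Hence `E g (A ∪ B) ≤ 2 E g B` (`sum_union_resampled_le`), while the law of `B` is that
of a random feasible set of items chosen independently of their states. So some mixture of sets of
`I` has at least `ε ^ 2 / 2` times the adaptive value (`DetPolicy.utility_le_items`), and the
approximation guarantee carries this over to the answers of the subroutine.

*The algorithm.* It is deterministic up to the draw of the index. Each pass through the loop costs
one comparison, one call of the subroutine and one assignment (`exists_run_test`), so that it halts
after at most `m * (δ + 2) + 4 ≤ 7 * (m * δ)` steps. The answer `E i` is returned with
probability `1 / m`, which accounts for the factor `1 / m`.
-/

namespace ARONSS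

/-! ### Submodular functions -/

section Submodular

variable {Ω : Type*} [DecidableEq Ω]

lemma IsSubmodular.union_sub_le {g : Finset Ω → ℝ} (hg : IsSubmodular g) {S T : Finset Ω}
    (hST : S ⊆ T) (V : Finset Ω) (hV : Disjoint V T) :
    g (V ∪ T) - g T ≤ g (V ∪ S) - g S := by
  induction V using Finset.induction_on with
  | empty => simp
  | insert v V hv ih =>
    rw [Finset.disjoint_insert_left] at hV
    have h := hg.2 (V ∪ S) (V ∪ T) (Finset.union_subset_union_right hST) v (by simp [hv, hV.1])
    rw [Finset.insert_union, Finset.insert_union]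
    linarith [ih hV.2]

lemma IsSubmodular.union_add_inter_le {g : Finset Ω → ℝ} (hg : IsSubmodular g)
    (X Y : Finset Ω) : g (X ∪ Y) + g (X ∩ Y) ≤ g X + g Y := by
  have h := hg.union_sub_le (S := X ∩ Y) Finset.inter_subset_right (X \ Y) Finset.sdiff_disjoint
  rw [Finset.sdiff_union_self_eq_union, Finset.sdiff_union_inter] at h
  linarith

/-- The monotone closure of a set function: its least value on the supersets of a set. -/
noncomputable def monotoneClosure [Fintype Ω] (g : Finset Ω → ℝ) (X : Finset Ω) : ℝ :=
  (Finset.univ.filter (X ⊆ ·)).inf' ⟨X, by simp⟩ g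

section

variable [Fintype Ω] (g : Finset Ω → ℝ)

lemma monotoneClosure_le {X Y : Finset Ω} (h : X ⊆ Y) : monotoneClosure g X ≤ g Y :=
  Finset.inf'_le _ (by simp [h])

lemma exists_monotoneClosure_eq (X : Finset Ω) : ∃ Y, X ⊆ Y ∧ monotoneClosure g X = g Y := by
  obtain ⟨Y, hY, h⟩ := Finset.exists_mem_eq_inf' (s := Finset.univ.filter (X ⊆ ·))
    ⟨X, by simp⟩ g
  exact ⟨Y, by simpa using hY, h⟩

lemma monotone_monotoneClosure : Monotone (monotoneClosure g) := by
  intro X Y hXY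
  obtain ⟨Z, hZ, h⟩ := exists_monotoneClosure_eq g Y
  exact h ▸ monotoneClosure_le g (hXY.trans hZ)

lemma monotoneClosure_union_add_inter_le {g : Finset Ω → ℝ} (hg : IsSubmodular g)
    (X Y : Finset Ω) :
    monotoneClosure g (X ∪ Y) + monotoneClosure g (X ∩ Y) ≤
      monotoneClosure g X + monotoneClosure g Y := by
  obtain ⟨X', hX, hX'⟩ := exists_monotoneClosure_eq g X
  obtain ⟨Y', hY, hY'⟩ := exists_monotoneClosure_eq g Y
  rw [hX', hY']
  exact (add_le_add (monotoneClosure_le g (Finset.union_subset_union hX hY))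
    (monotoneClosure_le g (Finset.inter_subset_inter hX hY))).trans (hg.union_add_inter_le X' Y')

end

/-- A monotone nearly submodular function is within the same factors of a submodular function
that is itself monotone. -/
lemma IsNearlySubmodular.exists_monotone [Fintype Ω] {ε : ℝ} (hε : 0 < ε) {f : Finset Ω → ℝ}
    (hf : IsNearlySubmodular ε f) (hmono : Monotone f) :
    ∃ g : Finset Ω → ℝ, (∀ X, 0 ≤ g X) ∧ Monotone g ∧
      (∀ X Y, g (X ∪ Y) + g (X ∩ Y) ≤ g X + g Y) ∧
      ∀ X, ε * g X ≤ f X ∧ f X ≤ 1 / ε * g X := by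
  obtain ⟨g, hg, hfg⟩ := hf
  refine ⟨monotoneClosure g, fun X => ?_, monotone_monotoneClosure g,
    monotoneClosure_union_add_inter_le hg, fun X => ⟨?_, ?_⟩⟩
  · obtain ⟨Y, -, h⟩ := exists_monotoneClosure_eq g X
    exact h ▸ hg.1 Y
  · exact (mul_le_mul_of_nonneg_left (monotoneClosure_le g subset_rfl) hε.le).trans (hfg X).1
  · obtain ⟨Y, hY, h⟩ := exists_monotoneClosure_eq g X
    exact h ▸ (hmono hY).trans (hfg Y).2

/-- Diminishing returns, without the proviso that the new element lies outside the larger set: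
monotonicity covers that case. -/
lemma insert_sub_le_insert_sub {g : Finset Ω → ℝ} (hmono : Monotone g)
    (hsub : ∀ X Y, g (X ∪ Y) + g (X ∩ Y) ≤ g X + g Y) {S T : Finset Ω} (hST : S ⊆ T) (v : Ω) :
    g (insert v T) - g T ≤ g (insert v S) - g S := by
  have h := hsub (insert v S) T
  rw [Finset.insert_union, Finset.union_eq_right.2 hST] at h
  have h' : g S ≤ g (insert v S ∩ T) :=
    hmono (Finset.subset_inter (Finset.subset_insert v S) hST)
  linarith

end Submodular

/-! ### Expectations over finite types -/

section Expectation

lemma expect_eq_sum {A : Type*} [Fintype A] (p : PMF A) (φ : A → ℝ) :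
    expect p φ = ∑ a, (p a).toReal * φ a :=
  tsum_fintype _

lemma sum_toReal_eq_one {A : Type*} [Fintype A] (p : PMF A) : ∑ a, (p a).toReal = 1 := by
  rw [← ENNReal.toReal_sum fun a _ => p.apply_ne_top a, ← tsum_fintype (L := .unconditional A),
    p.tsum_coe, ENNReal.toReal_one]

lemma expect_map {A B : Type*} [Fintype A] [Fintype B] (p : PMF A) (h : A → B) (φ : B → ℝ) :
    expect (p.map h) φ = expect p fun a => φ (h a) := by
  classical
  have key : ∀ b, ((p.map h) b).toReal = ∑ a, if b = h a then (p a).toReal else 0 := by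
    intro b
    rw [PMF.map_apply, tsum_fintype, ENNReal.toReal_sum]
    · refine Finset.sum_congr rfl fun a _ => ?_
      split_ifs <;> simp
    · intro a _
      split_ifs
      exacts [p.apply_ne_top a, ENNReal.zero_ne_top]
  simp only [expect_eq_sum, key, Finset.sum_mul]
  rw [Finset.sum_comm]
  simp [ite_mul]

lemma expect_nonneg {A : Type*} (p : PMF A) {φ : A → ℝ} (hφ : ∀ a, 0 ≤ φ a) : 0 ≤ expect p φ :=
  tsum_nonneg fun a => mul_nonneg ENNReal.toReal_nonneg (hφ a)

/-- A bound on the support of a distribution bounds the expectation. -/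
lemma expect_le_of_support {A : Type*} [Fintype A] (p : PMF A) {φ : A → ℝ} {c : ℝ}
    (h : ∀ a ∈ p.support, φ a ≤ c) : expect p φ ≤ c := by
  rw [expect_eq_sum]
  calc ∑ a, (p a).toReal * φ a ≤ ∑ a, (p a).toReal * c := by
        refine Finset.sum_le_sum fun a _ => ?_
        by_cases ha : p a = 0
        · simp [ha]
        · exact mul_le_mul_of_nonneg_left (h a ((p.mem_support_iff a).2 ha)) ENNReal.toReal_nonneg
    _ = c := by rw [← Finset.sum_mul, sum_toReal_eq_one, one_mul]

lemma const_mul_expect {A : Type*} (p : PMF A) (c : ℝ) (φ : A → ℝ) :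
    c * expect p φ = expect p fun a => c * φ a := by
  unfold expect
  rw [← tsum_mul_left]
  exact tsum_congr fun a => by ring

lemma toReal_prior {E O : Type*} [Fintype E] [DecidableEq E] [Fintype O] (D : E → PMF O)
    (y : E → O) : (prior D y).toReal = ∏ e, (D e (y e)).toReal := by
  simp [prior, ENNReal.toReal_prod]

end Expectation

/-! ### The course of a deterministic policy -/

section Observations

variable {E O : Type*} [DecidableEq E] [DecidableEq O]

/-- The item that the policy newly picks in round `t + 1` under the realization `y`: `none` if it
stops or selects an item again. -/
def DetPolicy.newItem (p : DetPolicy E O) (y : E → O) (t : ℕ) : Option E :=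
  (p (p.observed y t)).filter fun e => e ∉ (p.observed y t).image Prod.fst

variable (p : DetPolicy E O)

lemma DetPolicy.snd_eq_of_mem_observed (y : E → O) (t : ℕ) {x : E × O}
    (hx : x ∈ p.observed y t) : x.2 = y x.1 := by
  induction t with
  | zero => simp [DetPolicy.observed] at hx
  | succ t ih =>
    rw [DetPolicy.observed] at hx
    split at hx
    · exact ih hx
    · rcases Finset.mem_insert.1 hx with rfl | hx
      · rfl
      · exact ih hx

lemma DetPolicy.newItem_notMem {y : E → O} {t : ℕ} {e : E} (h : p.newItem y t = some e) :
    e ∉ (p.observed y t).image Prod.fst := by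
  have := (Option.filter_eq_some_iff.1 h).2
  simpa only [decide_eq_true_eq] using this

lemma DetPolicy.observed_succ_of_newItem {y : E → O} {t : ℕ} {e : E}
    (h : p.newItem y t = some e) :
    p.observed y (t + 1) = insert (e, y e) (p.observed y t) := by
  rw [DetPolicy.observed, (Option.filter_eq_some_iff.1 h).1]

lemma DetPolicy.observed_succ_of_newItem_none {y : E → O} {t : ℕ}
    (h : p.newItem y t = none) : p.observed y (t + 1) = p.observed y t := by
  rw [DetPolicy.observed]
  split
  · rfl
  · rename_i e he
    rw [DetPolicy.newItem, Option.filter_eq_none_iff] at h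
    have hmem : e ∈ (p.observed y t).image Prod.fst := by
      simpa only [decide_eq_true_eq, not_not] using h e he
    obtain ⟨x, hx, rfl⟩ := Finset.mem_image.1 hmem
    rw [← p.snd_eq_of_mem_observed y t hx]
    exact Finset.insert_eq_of_mem hx

/-- The observations depend on the states of the picked items only. -/
lemma DetPolicy.observed_congr {y y' : E → O} (t : ℕ)
    (h : ∀ e ∈ (p.observed y t).image Prod.fst, y' e = y e) :
    p.observed y' t = p.observed y t := by
  induction t with
  | zero => rfl
  | succ t ih =>
    have hsub : p.observed y t ⊆ p.observed y (t + 1) := by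
      rw [DetPolicy.observed]
      split
      exacts [subset_rfl, Finset.subset_insert _ _]
    have heq := ih fun e he => h e (Finset.image_subset_image hsub he)
    rw [DetPolicy.observed, DetPolicy.observed, heq]
    cases hp : p (p.observed y t) with
    | none => rfl
    | some e =>
      have : y' e = y e := h e (by simp [DetPolicy.observed, hp])
      simp only [this]

/-- The items picked under `y` within `t` rounds, taken with their states under `z`. -/
def DetPolicy.resampled (y z : E → O) (t : ℕ) : Finset (E × O) :=
  ((p.observed y t).image Prod.fst).image fun e => (e, z e)

lemma DetPolicy.resampled_succ_of_newItem {y z : E → O} {t : ℕ} {e : E}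
    (h : p.newItem y t = some e) :
    p.resampled y z (t + 1) = insert (e, z e) (p.resampled y z t) := by
  simp only [DetPolicy.resampled, p.observed_succ_of_newItem h, Finset.image_insert]

lemma DetPolicy.resampled_succ_of_newItem_none {y z : E → O} {t : ℕ}
    (h : p.newItem y t = none) : p.resampled y z (t + 1) = p.resampled y z t := by
  simp only [DetPolicy.resampled, p.observed_succ_of_newItem_none h]

/-! ### Exchanging the state of the new item -/

/-- Exchange, between two realizations, the state of the item that is newly picked under the
first one in round `t + 1`. -/
def DetPolicy.swapNew (t : ℕ) (x : (E → O) × (E → O)) : (E → O) × (E → O) :=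
  match p.newItem x.1 t with
  | none => x
  | some e => (Function.update x.1 e (x.2 e), Function.update x.2 e (x.1 e))

lemma DetPolicy.swapNew_of_newItem {t : ℕ} {y z : E → O} {e : E}
    (h : p.newItem y t = some e) :
    p.swapNew t (y, z) = (Function.update y e (z e), Function.update z e (y e)) := by
  simp [DetPolicy.swapNew, h]

lemma DetPolicy.observed_update_newItem {t : ℕ} {y : E → O} {e : E}
    (h : p.newItem y t = some e) (o : O) :
    p.observed (Function.update y e o) t = p.observed y t :=
  p.observed_congr t fun e' he' => Function.update_of_ne
    (fun h' : e' = e => p.newItem_notMem h (h' ▸ he')) _ _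

lemma DetPolicy.newItem_update_newItem {t : ℕ} {y : E → O} {e : E}
    (h : p.newItem y t = some e) (o : O) :
    p.newItem (Function.update y e o) t = some e := by
  rw [← h, DetPolicy.newItem, DetPolicy.newItem, p.observed_update_newItem h]

lemma DetPolicy.swapNew_involutive (t : ℕ) : Function.Involutive (p.swapNew t) := by
  rintro ⟨y, z⟩
  cases h : p.newItem y t with
  | none => simp [DetPolicy.swapNew, h]
  | some e =>
    rw [p.swapNew_of_newItem h, p.swapNew_of_newItem (p.newItem_update_newItem h _)]
    simp

lemma DetPolicy.resampled_update_newItem {t : ℕ} {y z : E → O} {e : E}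
    (h : p.newItem y t = some e) (o o' : O) :
    p.resampled (Function.update y e o) (Function.update z e o') t = p.resampled y z t := by
  rw [DetPolicy.resampled, DetPolicy.resampled, p.observed_update_newItem h]
  refine Finset.image_congr fun e' he' => ?_
  have hne : e' ≠ e := fun h' => p.newItem_notMem h (h' ▸ he')
  simp only [Function.update_of_ne hne]

lemma DetPolicy.prior_swapNew [Fintype E] [Fintype O] (D : E → PMF O) (t : ℕ)
    (x : (E → O) × (E → O)) :
    (prior D (p.swapNew t x).1).toReal * (prior D (p.swapNew t x).2).toReal =
      (prior D x.1).toReal * (prior D x.2).toReal := by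
  obtain ⟨y, z⟩ := x
  cases h : p.newItem y t with
  | none => simp [DetPolicy.swapNew, h]
  | some e =>
    rw [p.swapNew_of_newItem h]
    simp only [toReal_prior, ← Finset.prod_mul_distrib]
    refine Finset.prod_congr rfl fun e' _ => ?_
    by_cases he : e' = e
    · subst he
      simp [mul_comm]
    · simp [he]

/-! ### The adaptivity gap -/

variable {p} in
/-- One round enlarges `g (A ∪ B)` by at most two marginal values with respect to `B`; the first
of them is the second one at the exchanged pair of realizations. -/
lemma DetPolicy.union_resampled_succ_sub_le {g : Finset (E × O) → ℝ} (hmono : Monotone g)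
    (hsub : ∀ X Y, g (X ∪ Y) + g (X ∩ Y) ≤ g X + g Y) (t : ℕ) (x : (E → O) × (E → O)) :
    g (p.observed x.1 (t + 1) ∪ p.resampled x.1 x.2 (t + 1)) -
        g (p.observed x.1 t ∪ p.resampled x.1 x.2 t) ≤
      (g (p.resampled (p.swapNew t x).1 (p.swapNew t x).2 (t + 1)) -
          g (p.resampled (p.swapNew t x).1 (p.swapNew t x).2 t)) +
        (g (p.resampled x.1 x.2 (t + 1)) - g (p.resampled x.1 x.2 t)) := by
  obtain ⟨y, z⟩ := x
  cases h : p.newItem y t with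
  | none =>
    simp [DetPolicy.swapNew, h, p.observed_succ_of_newItem_none h,
      p.resampled_succ_of_newItem_none h]
  | some e =>
    simp only [p.swapNew_of_newItem h]
    rw [p.resampled_succ_of_newItem (p.newItem_update_newItem h _), p.resampled_update_newItem h,
      p.observed_succ_of_newItem h, p.resampled_succ_of_newItem h, Function.update_self]
    set A := p.observed y t
    set B := p.resampled y z t
    have h₁ := insert_sub_le_insert_sub hmono hsub (Finset.subset_union_right : B ⊆ A ∪ B) (e, y e)
    have h₂ := insert_sub_le_insert_sub hmono hsub
      ((Finset.subset_union_right : B ⊆ A ∪ B).trans (Finset.subset_insert (e, y e) _)) (e, z e)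
    have hU : insert (e, y e) A ∪ insert (e, z e) B =
        insert (e, z e) (insert (e, y e) (A ∪ B)) := by
      rw [Finset.union_insert, Finset.insert_union]
    rw [hU]
    linarith

variable [Fintype E] [Fintype O]

/-- In expectation over two independent realizations, the observed pairs together with the
resampled ones are worth at most twice the resampled ones. -/
lemma DetPolicy.sum_union_resampled_le (D : E → PMF O) {g : Finset (E × O) → ℝ}
    (hnonneg : ∀ X, 0 ≤ g X) (hmono : Monotone g)
    (hsub : ∀ X Y, g (X ∪ Y) + g (X ∩ Y) ≤ g X + g Y) (t : ℕ) :
    ∑ x : (E → O) × (E → O), (prior D x.1).toReal * (prior D x.2).toReal *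
        g (p.observed x.1 t ∪ p.resampled x.1 x.2 t) ≤
      2 * ∑ x : (E → O) × (E → O), (prior D x.1).toReal * (prior D x.2).toReal *
        g (p.resampled x.1 x.2 t) := by
  induction t with
  | zero =>
    rw [Finset.mul_sum]
    refine Finset.sum_le_sum fun x _ => ?_
    simp only [DetPolicy.observed, DetPolicy.resampled, Finset.image_empty, Finset.empty_union]
    have := mul_nonneg (mul_nonneg (prior D x.1).toReal_nonneg (prior D x.2).toReal_nonneg)
      (hnonneg ∅)
    linarith
  | succ t ih =>
    set w : (E → O) × (E → O) → ℝ := fun x => (prior D x.1).toReal * (prior D x.2).toReal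
    set R : (E → O) × (E → O) → ℝ := fun x =>
      g (p.resampled x.1 x.2 (t + 1)) - g (p.resampled x.1 x.2 t)
    have hswap : ∑ x, w x * R (p.swapNew t x) = ∑ x, w x * R x := by
      rw [← Equiv.sum_comp (p.swapNew_involutive t).toPerm fun x => w x * R x]
      refine Finset.sum_congr rfl fun x _ => ?_
      have hw : w (p.swapNew t x) = w x := p.prior_swapNew D t x
      simp only [Function.Involutive.coe_toPerm, hw]
    have hstep : ∑ x, w x * (g (p.observed x.1 (t + 1) ∪ p.resampled x.1 x.2 (t + 1)) -
        g (p.observed x.1 t ∪ p.resampled x.1 x.2 t)) ≤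
        ∑ x, w x * (R (p.swapNew t x) + R x) :=
      Finset.sum_le_sum fun x _ => mul_le_mul_of_nonneg_left
        (DetPolicy.union_resampled_succ_sub_le hmono hsub t x)
        (mul_nonneg ENNReal.toReal_nonneg ENNReal.toReal_nonneg)
    simp only [mul_add, Finset.sum_add_distrib, hswap] at hstep
    simp only [R, mul_sub, Finset.sum_sub_distrib] at hstep
    linarith

/-- The value of a deterministic adaptive policy is at most `2 / ε ^ 2` times the value of the
non-adaptive policy that runs it on a simulated realization and picks the same items. -/
lemma DetPolicy.utility_le_items (D : E → PMF O) {ε : ℝ} (hε : 0 < ε)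
    {f : Finset (E × O) → ℝ} (hmono : Monotone f) (hf : IsNearlySubmodular ε f) :
    ε ^ 2 / 2 * p.utility D f ≤ expect (prior D) fun y => setUtility D f (p.items y) := by
  obtain ⟨g, hg₀, hgm, hgs, hfg⟩ := hf.exists_monotone hε hmono
  set w : (E → O) × (E → O) → ℝ := fun x => (prior D x.1).toReal * (prior D x.2).toReal
  have hw : ∀ x, 0 ≤ w x := fun x => mul_nonneg ENNReal.toReal_nonneg ENNReal.toReal_nonneg
  set A : (E → O) × (E → O) → Finset (E × O) := fun x => p.observed x.1 (Fintype.card E)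
  set B : (E → O) × (E → O) → Finset (E × O) := fun x => p.resampled x.1 x.2 (Fintype.card E)
  have hgap : ∑ x, w x * g (A x ∪ B x) ≤ 2 * ∑ x, w x * g (B x) :=
    p.sum_union_resampled_le D hg₀ hgm hgs (Fintype.card E)
  have hA : p.utility D f = ∑ x, w x * f (A x) := by
    rw [DetPolicy.utility, expect_eq_sum, Fintype.sum_prod_type]
    refine Finset.sum_congr rfl fun y _ => ?_
    simp only [w, A]
    rw [← Finset.sum_mul, ← Finset.mul_sum, sum_toReal_eq_one, mul_one, DetPolicy.picked]
  have hB : (expect (prior D) fun y => setUtility D f (p.items y)) = ∑ x, w x * f (B x) := by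
    rw [expect_eq_sum, Fintype.sum_prod_type]
    refine Finset.sum_congr rfl fun y _ => ?_
    rw [setUtility, expect_eq_sum, Finset.mul_sum]
    exact Finset.sum_congr rfl fun z _ => (mul_assoc _ _ _).symm
  have h₁ : ε * ∑ x, w x * f (A x) ≤ ∑ x, w x * g (A x ∪ B x) := by
    rw [Finset.mul_sum]
    refine Finset.sum_le_sum fun x _ => ?_
    have h := (hmono (Finset.subset_union_left : A x ⊆ A x ∪ B x)).trans (hfg (A x ∪ B x)).2
    rw [one_div, ← div_eq_inv_mul, le_div_iff₀ hε] at h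
    nlinarith [mul_le_mul_of_nonneg_left h (hw x)]
  have h₂ : ε * ∑ x, w x * g (B x) ≤ ∑ x, w x * f (B x) := by
    rw [Finset.mul_sum]
    refine Finset.sum_le_sum fun x _ => ?_
    nlinarith [mul_le_mul_of_nonneg_left (hfg (B x)).1 (hw x)]
  rw [hA, hB]
  nlinarith [mul_le_mul_of_nonneg_left (h₁.trans hgap) hε.le]

/-- A set that is `c`-approximately optimal among the sets of `I` competes with every feasible
adaptive policy. -/
lemma AdaptivePolicy.mul_utility_le_setUtility {I : Set (Finset E)} {D : E → PMF O} {ε : ℝ}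
    (hε : 0 < ε) {f : Finset (E × O) → ℝ} (hmono : Monotone f)
    (hf : IsNearlySubmodular ε f) {c : ℝ} (hc : 0 ≤ c) {S : Finset E}
    (hS : ∀ S' ∈ I, c * setUtility D f S' ≤ setUtility D f S)
    {π : AdaptivePolicy E O} (hπ : AdaptivePolicy.Feasible I π) :
    ε ^ 2 / 2 * c * AdaptivePolicy.utility D f π ≤ setUtility D f S := by
  rw [AdaptivePolicy.utility, const_mul_expect]
  refine expect_le_of_support π fun p hp => ?_
  calc ε ^ 2 / 2 * c * p.utility D f = c * (ε ^ 2 / 2 * p.utility D f) := by ring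
    _ ≤ c * expect (prior D) fun y => setUtility D f (p.items y) :=
      mul_le_mul_of_nonneg_left (p.utility_le_items D hε hmono hf) hc
    _ ≤ setUtility D f S := by
      rw [const_mul_expect]
      exact expect_le_of_support _ fun y _ => hS _ (hπ p hp y)

end Observations

/-! ### The run of the algorithm -/

section Run

variable {E O : Type*} {m : ℕ} [NeZero m] {M : Procedure (SingleProblem E O) (Finset E)}
  {q : Fin m → SingleProblem E O}

lemma run_succ_of_pure {n : ℕ} {c : Config m M} (h : run M q n = PMF.pure c) :
    run M q (n + 1) = step M q c := by
  rw [run, h, PMF.pure_bind]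

/-- A call of the subroutine that returns after `t` steps takes `t` steps of the algorithm. -/
lemma run_call {i : Fin m} {T : Fin m → Finset E} {c : M.Cfg} {t : ℕ} {S : Finset E}
    (hr : M.Returns c t S) :
    ∀ {n : ℕ}, run M q n = PMF.pure (.call i T c) →
      run M q (n + t) = PMF.pure (.incr i (Function.update T i S)) := by
  induction hr with
  | done h =>
    intro n hn
    rw [run_succ_of_pure hn]
    simp [step, h]
  | @next c c' t a h _ ih =>
    intro n hn
    have h' : run M q (n + 1) = PMF.pure (.call i T c') := by
      rw [run_succ_of_pure hn]
      simp [step, h]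
    rw [show n + (t + 1) = n + 1 + t by omega]
    exact ih h'

/-- After `k` passes through the loop, within `k * (δ + 2) + 1` steps, the memory holds the first
`k` answers of the subroutine. -/
lemma exists_run_test {δ : ℕ} {t : Fin m → ℕ} {S : Fin m → Finset E} (ht : ∀ i, t i ≤ δ)
    (hr : ∀ i, M.Returns (M.start (q i)) (t i) (S i)) (k : ℕ) (hk : k ≤ m) :
    ∃ n ≤ k * (δ + 2) + 1, ∃ T : Fin m → Finset E, (∀ i : Fin m, (i : ℕ) < k → T i = S i) ∧
      run M q n = PMF.pure (.test k T) := by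
  induction k with
  | zero =>
    refine ⟨1, by omega, fun _ => ∅, fun i hi => absurd hi (Nat.not_lt_zero _), ?_⟩
    rw [run_succ_of_pure (c := .init) rfl, step]
  | succ k ih =>
    obtain ⟨n, hn, T, hT, hrun⟩ := ih (by omega)
    have hkm : k < m := hk
    have h₁ : run M q (n + 1) = PMF.pure (.call ⟨k, hkm⟩ T (M.start (q ⟨k, hkm⟩))) := by
      rw [run_succ_of_pure hrun]
      simp [step, hkm]
    have h₂ := run_succ_of_pure (run_call (hr ⟨k, hkm⟩) h₁)
    refine ⟨n + 1 + t ⟨k, hkm⟩ + 1, ?_, Function.update T ⟨k, hkm⟩ (S ⟨k, hkm⟩), ?_, ?_⟩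
    · have := ht ⟨k, hkm⟩
      rw [add_mul]
      omega
    · intro i hi
      by_cases h : i = ⟨k, hkm⟩
      · rw [h, Function.update_self]
      · rw [Function.update_of_ne h]
        have : (i : ℕ) ≠ k := fun h' => h (Fin.ext h')
        exact hT i (by omega)
    · rw [h₂, step]

/-- The algorithm returns a uniformly random answer of the subroutine. -/
lemma exists_haltsWith {δ : ℕ} {t : Fin m → ℕ} {S : Fin m → Finset E} (ht : ∀ i, t i ≤ δ)
    (hr : ∀ i, M.Returns (M.start (q i)) (t i) (S i)) :
    ∃ n ≤ m * (δ + 2) + 4, HaltsWith M q n ((PMF.uniformOfFintype (Fin m)).map S) := by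
  obtain ⟨n, hn, T, hT, hrun⟩ := exists_run_test ht hr m le_rfl
  obtain rfl : T = S := funext fun i => hT i i.isLt
  have h₁ : run M q (n + 1) = PMF.pure (.draw T) := by
    rw [run_succ_of_pure hrun]
    simp [step]
  refine ⟨n + 1 + 1 + 1, by omega, ?_⟩
  rw [HaltsWith, run, run_succ_of_pure h₁, step, PMF.bind_map, PMF.map_comp]
  rfl

end Run

lemma Procedure.Returns.one_le {Q A : Type*} {M : Procedure Q A} {c : M.Cfg} {t : ℕ} {a : A}
    (h : M.Returns c t a) : 1 ≤ t := by
  cases h <;> omega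

lemma setUtility_nonneg {E O : Type*} [Fintype E] [DecidableEq E] [Fintype O] [DecidableEq O]
    (D : E → PMF O) {f : Finset (E × O) → ℝ} (hf : ∀ X, 0 ≤ f X) (S : Finset E) :
    0 ≤ setUtility D f S :=
  expect_nonneg _ fun _ => hf _

/-- The answer `S i` contributes `1 / m` of its value to that of a uniformly random answer. -/
lemma setUtility_div_le_utility_uniform {E O : Type*} [Fintype E] [DecidableEq E] [Fintype O]
    [DecidableEq O] {m : ℕ} [NeZero m] (D : E → PMF O) {f : Finset (E × O) → ℝ}
    (hf : ∀ X, 0 ≤ f X) (S : Fin m → Finset E) (i : Fin m) :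
    setUtility D f (S i) / m ≤
      NonadaptivePolicy.utility D f ((PMF.uniformOfFintype (Fin m)).map S) := by
  rw [NonadaptivePolicy.utility, expect_map, expect_eq_sum]
  refine le_of_eq_of_le ?_ (Finset.single_le_sum (fun j _ => mul_nonneg ENNReal.toReal_nonneg
    (setUtility_nonneg D hf (S j))) (Finset.mem_univ i))
  simp [div_eq_inv_mul]

end ARONSS

open ARONSS in
theorem mainTheorem3 :
    ∃ C : ℕ,
      ∀ (E O : Type*) [Fintype E] [DecidableEq E] [Fintype O] [DecidableEq O]
        (m : ℕ) [NeZero m]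
        (I : Set (Finset E)) (_hI : IsLowerSet I)
        (D : E → PMF O)
        (ε : ℝ) (_hε₀ : 0 < ε) (_hε₁ : ε ≤ 1)
        (F : Fin m → Finset (E × O) → ℝ)
        (_hnonneg : ∀ i X, 0 ≤ F i X)
        (_hmono : ∀ i, Monotone (F i))
        (_hnear : ∀ i, IsNearlySubmodular ε (F i))
        (APPROX : Procedure (SingleProblem E O) (Finset E))
        (α : Fin m → ℝ) (δ : ℕ)
        (_hAPPROX : ∀ i, ApproximatesWithin APPROX ⟨I, D, F i⟩ (α i) δ),
        ∃ (σ : NonadaptivePolicy E) (t : ℕ),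
          HaltsWith APPROX (fun i => ⟨I, D, F i⟩) t σ ∧
          t ≤ C * (m * δ) ∧
          NonadaptivePolicy.Feasible I σ ∧
          ∀ π : AdaptivePolicy E O, AdaptivePolicy.Feasible I π →
            ε ^ 2 * (⨅ i, α i) / (2 * (m : ℝ)) * AdaptivePolicy.robustUtility D F π ≤
              NonadaptivePolicy.robustUtility D F σ := by
  refine ⟨7, fun E O _ _ _ _ m _ I _ D ε hε _ F hnonneg hmono hnear M α δ hM => ?_⟩
  choose t S htδ hret hSI happrox using hM
  have hm : 1 ≤ m := NeZero.one_le
  have hm' : (0 : ℝ) < m := by exact_mod_cast hm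
  obtain ⟨n, hn, hhalt⟩ := exists_haltsWith htδ hret
  refine ⟨_, n, hhalt, ?_, ?_, fun π hπ => ?_⟩
  · -- Every call takes a step, so `1 ≤ δ`, and `m * (δ + 2) + 4 ≤ 7 * (m * δ)` follows.
    have hδ : 1 ≤ δ := (hret ⟨0, hm⟩).one_le.trans (htδ _)
    have hmδ : m ≤ m * δ := Nat.le_mul_of_pos_right m hδ
    rw [mul_add] at hn
    omega
  · intro T hT
    obtain ⟨i, -, rfl⟩ := (PMF.mem_support_map_iff _ _ _).1 hT
    exact hSI i
  · have : Nonempty (Fin m) := ⟨⟨0, hm⟩⟩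
    have hU : ∀ i, 0 ≤ AdaptivePolicy.utility D (F i) π := fun i =>
      expect_nonneg _ fun p => expect_nonneg _ fun y => hnonneg i _
    have hrob : 0 ≤ AdaptivePolicy.robustUtility D F π := le_ciInf hU
    refine le_ciInf fun i => ?_
    refine le_trans ?_ (setUtility_div_le_utility_uniform D (hnonneg i) S i)
    rw [le_div_iff₀ hm']
    have hrw : ε ^ 2 * (⨅ i, α i) / (2 * (m : ℝ)) * AdaptivePolicy.robustUtility D F π * m =
        ε ^ 2 / 2 * (⨅ i, α i) * AdaptivePolicy.robustUtility D F π := by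
      field_simp
    rw [hrw]
    have hbdd : ∀ φ : Fin m → ℝ, BddBelow (Set.range φ) := fun φ => (Set.finite_range φ).bddBelow
    -- Nothing makes the guarantees `α i` non-negative; a negative one asserts nothing.
    rcases lt_or_ge (⨅ i, α i) 0 with hα | hα
    · refine le_trans ?_ (setUtility_nonneg D (hnonneg i) (S i))
      exact mul_nonpos_of_nonpos_of_nonneg
        (mul_nonpos_of_nonneg_of_nonpos (by positivity) hα.le) hrob
    · refine le_trans (mul_le_mul_of_nonneg_left (ciInf_le (hbdd _) i) (by positivity))
        (AdaptivePolicy.mul_utility_le_setUtility hε (hmono i) (hnear i) hα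
          (fun S' hS' => le_trans ?_ (happrox i S' hS')) hπ)
      exact mul_le_mul_of_nonneg_right (ciInf_le (hbdd α) i)
        (setUtility_nonneg D (hnonneg i) S')
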